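/- Equip $X^\omega$ ($X=2=\{0,1\}$ or $X=\omega$) with the metric $d(x,y)=2^{-k}$, where $k$ is least with $x(k)\ne y(k)$ (and $d(x,x)=0$); call $f:X^\omega\to X^\omega$ *Lipschitz* if $d(f(x),f(y))\le d(x,y)$ for all $x,y$. A set $A\subseteq X^\omega$ is *$\aleph_1$-dense* if $|A\cap U|=\aleph_1$ for every non-empty open $U\subseteq X^\omega$. * $\overline{\mathsf{BA}}_{\rm Lip}(\omega^\omega)$ is the statement: for all $\aleph_1$-dense $A,B\subseteq\omega^\omega$ there is a Lipschitz $f:\omega^\omega\to\omega^\omega$ that maps $A$ bijectively onto $B$. * $\overline{\mathsf{BA}}_{\rm Lip}(2^\omega)$ is the statement: for all $\aleph_1$-dense $A,B\subseteq 2^\omega$ there are Lipschitz $f_n:2^\omega\to2^\omega$ ($n<\omega$) with $B=\bigcup_{n<\omega}f_n[A]$. A set $A\subseteq2^\omega$ is *null-additive* if $A+N=\{a+x : a\in A,\ x\in N\}$ (coordinatewise addition mod 2) is null for every null $N\subseteq 2^\omega$, where null refers to the uniform product measure on $2^\omega$. Let $\mathcal N$ and $\mathcal M$ be the ideals of Lebesgue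 null and of meagre subsets of $\mathbb R$. For such an ideal $\mathcal I$ let $\mathrm{add}(\mathcal I)$ be the least size of a subfamily of $\mathcal I$ whose union is not in $\mathcal I$, $\mathrm{cov}(\mathcal I)$ the least size of a subfamily of $\mathcal I$ with union $\mathbb R$, $\mathrm{non}(\mathcal I)$ the least size of a subset of $\mathbb R$ not in $\mathcal I$, and $\mathrm{cof}(\mathcal I)$ the least size of a subfamily of $\mathcal I$ that is cofinal in $\mathcal I$ under inclusion. Let $\mathfrak b$ and $\mathfrak d$ be the least sizes of an unbounded and of a dominating family in $\omega^\omega$ under eventual domination $\le^*$. **Theorem.** Assume $\overline{\mathsf{BA}}_{\rm Lip}(2^\omega)$ or $\overline{\mathsf{BA}}_{\rm Lip}(\omega^\omega)$. Then every $A\subseteq 2^\omega$ of size $\aleph_1$ is null-additive, $\mathrm{add}(\mathcal N)>\aleph_1$, and every cardinal in Cichoń's diagram exceeds $\aleph_1$: each of $\mathrm{add}(\mathcal N)$, $\mathrm{cov}(\mathcal N)$, $\mathrm{non}(\mathcal N)$, $\mathrm{cof}(\mathcal N)$, $\mathrm{add}(\mathcal M)$, $\mathrm{cov}(\mathcal M)$,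 $\mathrm{non}(\mathcal M)$, $\mathrm{cof}(\mathcal M)$, $\mathfrak b$, $\mathfrak d$ and $2^{\aleph_0}$ is greater than $\aleph_1$. -/

import Mathlib

open Cardinal
open scoped Pointwise

noncomputable section

/-- The Baire space `ω^ω`, with the product of the discrete topologies. -/
abbrev BaireSpc : Type := ℕ → ℕ

/-- The Cantor space `2^ω`, with the product of the discrete topologies and with
coordinatewise addition modulo 2. -/
abbrev CantorSpc : Type := ℕ → Fin 2

/-- `A` is `ℵ₁`-dense: it meets every non-empty open set in a set of cardinality `ℵ₁`. -/
def IsAlephOneDense {Z : Type} [TopologicalSpace Z] (A : Set Z) : Prop :=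
  ∀ U : Set Z, IsOpen U → U.Nonempty → #(A ∩ U : Set Z) = ℵ₁

/-- `f : X^ω → X^ω` is Lipschitz with constant `1` for the metric `d(x, y) = 2⁻ᵏ`, where `k` is the
first index at which `x` and `y` differ (and `d(x, x) = 0`). -/
def IsLip {X : Type} (f : (ℕ → X) → (ℕ → X)) : Prop :=
  ∀ x y : ℕ → X, PiNat.dist.dist (f x) (f y) ≤ PiNat.dist.dist x y

/-- The strong Lipschitz Baumgartner axiom for `ω^ω`. -/
def StrongBALipBaire : Prop :=
  ∀ A B : Set BaireSpc, IsAlephOneDense A → IsAlephOneDense B →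
    ∃ f : BaireSpc → BaireSpc, IsLip f ∧ Set.BijOn f A B

/-- The strong Lipschitz Baumgartner axiom for `2^ω`. -/
def StrongBALipCantor : Prop :=
  ∀ A B : Set CantorSpc, IsAlephOneDense A → IsAlephOneDense B →
    ∃ f : ℕ → CantorSpc → CantorSpc, (∀ n, IsLip (f n)) ∧ B = ⋃ n, f n '' A

/-- The uniform (fair coin tossing) product probability measure on `2^ω`. -/
def cantorMeasure : MeasureTheory.Measure CantorSpc :=
  MeasureTheory.Measure.infinitePi fun _ : ℕ => ProbabilityTheory.uniformOn (Set.univ : Set (Fin 2))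

/-- `A ⊆ 2^ω` is null-additive: `A + N` is null for every null set `N ⊆ 2^ω`. -/
def IsNullAdditive (A : Set CantorSpc) : Prop :=
  ∀ N : Set CantorSpc, cantorMeasure N = 0 → cantorMeasure (A + N) = 0

/-- The ideal `𝒩` of Lebesgue null sets of reals. -/
def nullIdeal : Set (Set ℝ) := {s | MeasureTheory.volume s = 0}

/-- The ideal `ℳ` of meagre sets of reals. -/
def meagreIdeal : Set (Set ℝ) := {s | IsMeagre s}

/-- `add(I)`: the least size of a subfamily of `I` whose union is not in `I`. -/
def addChar (I : Set (Set ℝ)) : Cardinal.{0} :=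
  sInf {κ | ∃ F : Set (Set ℝ), F ⊆ I ∧ ⋃₀ F ∉ I ∧ #F = κ}

/-- `cov(I)`: the least size of a subfamily of `I` covering the real line. -/
def covChar (I : Set (Set ℝ)) : Cardinal.{0} :=
  sInf {κ | ∃ F : Set (Set ℝ), F ⊆ I ∧ ⋃₀ F = Set.univ ∧ #F = κ}

/-- `non(I)`: the least size of a set of reals that is not in `I`. -/
def nonChar (I : Set (Set ℝ)) : Cardinal.{0} :=
  sInf {κ | ∃ s : Set ℝ, s ∉ I ∧ #s = κ}

/-- `cof(I)`: the least size of a subfamily of `I` that is cofinal in `I` under inclusion. -/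
def cofChar (I : Set (Set ℝ)) : Cardinal.{0} :=
  sInf {κ | ∃ F : Set (Set ℝ), F ⊆ I ∧ (∀ s ∈ I, ∃ t ∈ F, s ⊆ t) ∧ #F = κ}

/-- `f ≤* g`: `f k ≤ g k` for all but finitely many `k`. -/
def EvDominatedBy (f g : ℕ → ℕ) : Prop := {k | ¬ f k ≤ g k}.Finite

/-- The bounding number `𝔟`. -/
def boundingNumber : Cardinal.{0} :=
  sInf {κ | ∃ F : Set (ℕ → ℕ), (¬ ∃ g, ∀ f ∈ F, EvDominatedBy f g) ∧ #F = κ}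

/-- The dominating number `𝔡`. -/
def dominatingNumber : Cardinal.{0} :=
  sInf {κ | ∃ F : Set (ℕ → ℕ), (∀ f, ∃ g ∈ F, EvDominatedBy f g) ∧ #F = κ}

end

/-! A Lipschitz map determines the first `n` values of its output from the first `n` values of its
input. Take for `A` the finite modifications of an `ℵ₁`-sized set of sequences carrying free bits
only at the sparse positions `P k`: up to finite changes it has only `2 ^ k` prefixes of length `P
k`. If countably many Lipschitz images of `A` cover a dense `B` containing a given `ℵ₁`-sized
family, the prefixes of that family are almost all caught in sets of size `4 ^ k`
(`LipCover.exists_prefix_slalom`). Over `ω` this is already `SlalomCapture`. Over `2` functions must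
be coded in binary blocks of bounded length, so `ℵ₁ < 𝔟` is needed first. If it failed, an unbounded
chain would give a dense set concentrated on the eventually zero sequences; its Lipschitz images
have countable fibres over all but countably many even parts, too small to cover an interleaved
product (`LipCover.alephOneBounded`).

Slalom capture makes unions of `ℵ₁` null sets null by Borel–Cantelli; null-additivity is the case of
translates. It also yields bounds and infinitely often equal functions, which together handle unions
of `ℵ₁` meagre sets. The remaining characteristics follow formally. -/

open Filter

/-! ### Finite modifications and `ℵ₁`-dense sets -/

/-- Overwrite an initial segment of `t` by the list `l`. -/
def splice {X : Type} (l : List X) (t : ℕ → X) : ℕ → X := fun n => l.getD n (t n)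

theorem exists_splice_eq {X : Type} {x t : ℕ → X} (h : ∀ᶠ n in atTop, x n = t n) :
    ∃ l : List X, x = splice l t := by
  obtain ⟨m, hm⟩ := eventually_atTop.1 h
  refine ⟨List.ofFn fun i : Fin m => x i, funext fun n => ?_⟩
  rcases lt_or_ge n m with hn | hn
  · simp [splice, List.getD, hn]
  · simp [splice, List.getD, hn, hm n hn]

theorem countable_eventuallyEq {X : Type} [Countable X] (t : ℕ → X) :
    {x : ℕ → X | ∀ᶠ n in atTop, x n = t n}.Countable := by
  refine (Set.countable_range fun l : List X => splice l t).mono ?_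
  intro x hx
  obtain ⟨l, rfl⟩ := exists_splice_eq hx
  exact ⟨l, rfl⟩

/-- The sequences that eventually agree with an element of `T`. -/
def tailClosure {X : Type} (T : Set (ℕ → X)) : Set (ℕ → X) :=
  {x | ∃ t ∈ T, ∀ᶠ n in atTop, x n = t n}

theorem subset_tailClosure {X : Type} (T : Set (ℕ → X)) : T ⊆ tailClosure T :=
  fun t ht => ⟨t, ht, Eventually.of_forall fun _ => rfl⟩

theorem mk_biUnion_le_aleph_one {α β : Type} {s : Set α} (hs : #s ≤ ℵ₁) {f : α → Set β}
    (hf : ∀ a ∈ s, (f a).Countable) : #(⋃ a ∈ s, f a : Set β) ≤ ℵ₁ := by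
  rw [Set.biUnion_eq_iUnion]
  refine (mk_iUnion_le _).trans ?_
  calc _ ≤ ℵ₁ * ℵ₀ := mul_le_mul' hs (ciSup_le' fun a : s => (le_aleph0_iff_set_countable.2 (hf a.1 a.2)))
    _ = ℵ₁ := by rw [mul_eq_left (aleph0_le_aleph 1) (aleph0_le_aleph 1) aleph0_ne_zero]

/-- Every element of `T` enters `U` after a finite change. A countable trace on `U` would thus cover
`T` by countably many countable classes. -/
theorem isAlephOneDense_tailClosure {X : Type} [Countable X] [TopologicalSpace X]
    [DiscreteTopology X] {T : Set (ℕ → X)} (hT : #T = ℵ₁) : IsAlephOneDense (tailClosure T) := by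
  intro U hU hne
  apply le_antisymm
  · refine (mk_le_mk_of_subset Set.inter_subset_left).trans ?_
    have : tailClosure T = ⋃ t ∈ T, {x : ℕ → X | ∀ᶠ n in atTop, x n = t n} := by
      ext x; simp [tailClosure]
    rw [this]
    exact mk_biUnion_le_aleph_one hT.le fun t _ => countable_eventuallyEq t
  · rw [aleph_one_le_iff]
    by_contra! hc
    rw [le_aleph0_iff_set_countable] at hc
    have hsub : T ⊆ ⋃ x ∈ tailClosure T ∩ U, {t | ∀ᶠ n in atTop, t n = x n} := by
      intro t ht
      obtain ⟨u, hu⟩ := hne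
      obtain ⟨V, ⟨y, n, rfl⟩, huV, hVU⟩ :=
        (PiNat.isTopologicalBasis_cylinders fun _ : ℕ => X).exists_subset_of_mem_open hu hU
      let x : ℕ → X := fun k => if k < n then y k else t k
      have hxt : ∀ᶠ k in atTop, t k = x k :=
        (eventually_ge_atTop n).mono fun k hk => by simp [x, not_lt.2 hk]
      refine Set.mem_biUnion (x := x) ⟨⟨t, ht, hxt.mono fun _ h => h.symm⟩, hVU ?_⟩ hxt
      rw [PiNat.mem_cylinder_iff]
      intro i hi
      simp [x, hi]
    have : T.Countable := (hc.biUnion fun x _ => countable_eventuallyEq x).mono hsub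
    rw [← le_aleph0_iff_set_countable, hT] at this
    exact absurd this (not_le.2 aleph0_lt_aleph_one)

theorem aleph_one_le_mk_seq (X : Type) [Nontrivial X] : ℵ₁ ≤ #(ℕ → X) := by
  rw [aleph_one_le_iff]
  calc ℵ₀ < 2 ^ ℵ₀ := cantor _
    _ ≤ #X ^ #ℕ := by
      rw [mk_nat]
      exact power_le_power_right (by rwa [two_le_iff, ← nontrivial_iff])
    _ = #(ℕ → X) := by simp

theorem exists_mk_eq_aleph_one_superset {X ι : Type} [Nontrivial X] (hι : #ι ≤ ℵ₁)
    (b : ι → ℕ → X) : ∃ T : Set (ℕ → X), #T = ℵ₁ ∧ ∀ i, b i ∈ T := by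
  obtain ⟨T, hT⟩ := (le_mk_iff_exists_set (c := ℵ₁)).1 (aleph_one_le_mk_seq X)
  refine ⟨T ∪ Set.range b, le_antisymm ?_ ?_, fun i => Or.inr ⟨i, rfl⟩⟩
  · refine (mk_union_le _ _).trans ?_
    calc _ ≤ ℵ₁ + ℵ₁ := add_le_add hT.le (mk_range_le.trans hι)
      _ = ℵ₁ := add_eq_self (aleph0_le_aleph 1)
  · exact hT.ge.trans (mk_le_mk_of_subset Set.subset_union_left)

/-! ### Lipschitz covers and prefix counting -/

theorem IsLip.agree {X : Type} {f : (ℕ → X) → ℕ → X} (hf : IsLip f) {x y : ℕ → X} {n : ℕ}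
    (h : ∀ k < n, x k = y k) : ∀ k < n, f x k = f y k := by
  rw [← PiNat.mem_cylinder_iff (E := fun _ => X)] at h ⊢
  rw [PiNat.mem_cylinder_iff_dist_le] at h ⊢
  exact (hf x y).trans h

/-- Every `ℵ₁`-dense set is covered by countably many Lipschitz images of any other one. -/
def LipCover (X : Type) [TopologicalSpace X] : Prop :=
  ∀ A B : Set (ℕ → X), IsAlephOneDense A → IsAlephOneDense B →
    ∃ f : ℕ → (ℕ → X) → ℕ → X, (∀ n, IsLip (f n)) ∧ B ⊆ ⋃ n, f n '' A

theorem StrongBALipBaire.lipCover (h : StrongBALipBaire) : LipCover ℕ := by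
  intro A B hA hB
  obtain ⟨f, hf, hAB⟩ := h A B hA hB
  exact ⟨fun _ => f, fun _ => hf, by rw [Set.iUnion_const, hAB.image_eq]⟩

theorem StrongBALipCantor.lipCover (h : StrongBALipCantor) : LipCover (Fin 2) := by
  intro A B hA hB
  obtain ⟨f, hf, hAB⟩ := h A B hA hB
  exact ⟨f, hf, hAB.le⟩

/-- The sequence carrying `y k` at position `P k` and `a` everywhere else. -/
noncomputable def stretch {X : Type} (a b : X) (P : ℕ → ℕ) (y : ℕ → Bool) : ℕ → X :=
  open Classical in fun n => if ∃ k, P k = n ∧ y k = true then b else a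

theorem stretch_apply {X : Type} (a b : X) {P : ℕ → ℕ} (hP : StrictMono P) (y : ℕ → Bool)
    (k : ℕ) : stretch a b P y (P k) = if y k = true then b else a := by
  simp [stretch, hP.injective.eq_iff]

theorem stretch_injective {X : Type} {a b : X} (hab : a ≠ b) {P : ℕ → ℕ} (hP : StrictMono P) :
    Function.Injective (stretch a b P) := by
  intro y z h
  ext k
  have := congrFun h (P k)
  rw [stretch_apply _ _ hP, stretch_apply _ _ hP] at this
  cases hy : y k <;> cases hz : z k <;> simp [hy, hz, hab, hab.symm] at this ⊢

theorem stretch_agree {X : Type} (a b : X) {P : ℕ → ℕ} (hP : StrictMono P) {y z : ℕ → Bool}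
    {k : ℕ} (h : ∀ j < k, y j = z j) : ∀ n < P k, stretch a b P y n = stretch a b P z n := by
  intro n hn
  have : (∃ j, P j = n ∧ y j = true) ↔ ∃ j, P j = n ∧ z j = true := by
    refine exists_congr fun j => and_congr_right fun hj => ?_
    rw [h j (hP.lt_iff_lt.1 (hj.trans_lt hn))]
  by_cases hy : ∃ j, P j = n ∧ y j = true
  · rw [stretch, stretch, if_pos hy, if_pos (this.1 hy)]
  · rw [stretch, stretch, if_neg hy, if_neg (this.not.1 hy)]

theorem splice_agree {X : Type} (l : List X) {x y : ℕ → X} {n : ℕ}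
    (h : ∀ k < n, x k = y k) : ∀ k < n, splice l x k = splice l y k := by
  intro k hk
  simp [splice, h k hk]

theorem LipCover.exists_prefix_slalom {X : Type} [Countable X] [Nontrivial X]
    [TopologicalSpace X] [DiscreteTopology X] (hX : LipCover X) {ι : Type} (hι : #ι ≤ ℵ₁)
    (b : ι → ℕ → X) {P : ℕ → ℕ} (hP : StrictMono P) :
    ∃ S : ℕ → Finset (ℕ → X), (∀ k, (S k).card ≤ 4 ^ k) ∧
      ∀ i, ∀ᶠ k in atTop, ∃ s ∈ S k, ∀ n < P k, s n = b i n := by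
  classical
  obtain ⟨c, d, hcd⟩ := exists_pair_ne X
  obtain ⟨Y, hY⟩ := (le_mk_iff_exists_set (c := ℵ₁)).1 (aleph_one_le_mk_seq Bool)
  obtain ⟨T, hT, hbT⟩ := exists_mk_eq_aleph_one_superset hι b
  have hA : #(stretch c d P '' Y) = ℵ₁ := by rw [mk_image_eq (stretch_injective hcd hP), hY]
  obtain ⟨f, hf, hcov⟩ := hX _ _ (isAlephOneDense_tailClosure hA) (isAlephOneDense_tailClosure hT)
  obtain ⟨e, he⟩ := exists_surjective_nat (ℕ × List X)
  -- Below `P k` a stretched sequence depends only on its first `k` bits, so these `2 ^ k`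
  -- representatives give all prefixes.
  let R : ℕ → Finset (ℕ → X) := fun k =>
    Finset.univ.image fun z : Fin k → Bool =>
      stretch c d P fun j => if h : j < k then z ⟨j, h⟩ else false
  have hR : ∀ k, (R k).card ≤ 2 ^ k := fun k => Finset.card_image_le.trans (by simp)
  -- Stage `k` uses only the first `k` pairs (map, overwritten prefix); each pair enters eventually,
  -- and `k * 2 ^ k ≤ 4 ^ k`.
  refine ⟨fun k => (Finset.range k).biUnion fun j =>
    (R k).image fun r => f (e j).1 (splice (e j).2 r), fun k => ?_, fun i => ?_⟩
  · calc _ ≤ ∑ j ∈ Finset.range k, 2 ^ k :=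
        Finset.card_biUnion_le.trans
          (Finset.sum_le_sum fun j _ => Finset.card_image_le.trans (hR k))
      _ = k * 2 ^ k := by simp
      _ ≤ 2 ^ k * 2 ^ k := Nat.mul_le_mul_right _ Nat.lt_two_pow_self.le
      _ = 4 ^ k := (mul_pow 2 2 k).symm
  · obtain ⟨m, x, ⟨t, ⟨y, -, rfl⟩, hxt⟩, hx⟩ :=
      Set.mem_iUnion.1 (hcov (subset_tailClosure T (hbT i)))
    obtain ⟨l, rfl⟩ := exists_splice_eq hxt
    obtain ⟨j, hj⟩ := he (m, l)
    filter_upwards [eventually_gt_atTop j] with k hk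
    refine ⟨f m (splice l (stretch c d P fun j => if j < k then y j else false)), ?_, ?_⟩
    · refine Finset.mem_biUnion.2 ⟨j, Finset.mem_range.2 hk, ?_⟩
      rw [hj]
      exact Finset.mem_image_of_mem _
        (Finset.mem_image.2 ⟨fun j => y j, Finset.mem_univ _, by simp⟩)
    · rw [← hx]
      exact (hf m).agree (splice_agree l (stretch_agree c d hP fun j hj => by simp [hj]))

/-! ### Null sets from slaloms -/

/-- Every family of at most `ℵ₁` functions is captured by one slalom of width `4 ^ (n + 1)`. -/
def SlalomCapture : Prop :=
  ∀ {ι : Type}, #ι ≤ ℵ₁ → ∀ f : ι → ℕ → ℕ, ∃ S : ℕ → Finset ℕ,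
    (∀ n, (S n).card ≤ 4 ^ (n + 1)) ∧ ∀ i, ∀ᶠ n in atTop, f i n ∈ S n

open MeasureTheory in
-- Covers of total measure at most `2⁻¹ ^ j`, one for each `j`, are merged into one summable
-- sequence and cut into finite blocks with small tails. Staying in a countable algebra lets each
-- block be coded by a natural number.
theorem exists_small_cover_of_measure_zero {α : Type*} [TopologicalSpace α]
    [SecondCountableTopology α] [MeasurableSpace α] [OpensMeasurableSpace α] (μ : Measure α)
    [μ.OuterRegular] {N : Set α} (hN : μ N = 0) {δ : ℕ → ENNReal} (hδ : ∀ k, 0 < δ k) :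
    ∃ C : ℕ → Set α,
      (∀ k, C k ∈ generateSetAlgebra (TopologicalSpace.countableBasis α) ∧ μ (C k) ≤ δ k) ∧
      ∀ x ∈ N, ∃ᶠ k in atTop, x ∈ C k := by
  set 𝒜 := generateSetAlgebra (TopologicalSpace.countableBasis α) with h𝒜
  have hA : IsSetAlgebra 𝒜 := isSetAlgebra_generateSetAlgebra
  have hmeas : ∀ s ∈ 𝒜, MeasurableSet s := by
    intro s hs
    have h1 : MeasurableSet[MeasurableSpace.generateFrom 𝒜] s :=
      MeasurableSpace.measurableSet_generateFrom hs
    rw [generateFrom_generateSetAlgebra_eq] at h1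
    refine MeasurableSpace.generateFrom_le (fun t ht => ?_) s h1
    exact ((TopologicalSpace.isBasis_countableBasis α).isOpen ht).measurableSet
  have hU : ∀ j : ℕ, ∃ D : ℕ → Set α, (∀ i, D i ∈ 𝒜) ∧ N ⊆ ⋃ i, D i ∧
      ∑' i, μ (D i) ≤ (2⁻¹ : ENNReal) ^ j := by
    intro j
    obtain ⟨U, hNU, hUo, hUj⟩ := Set.exists_isOpen_lt_of_lt N ((2⁻¹ : ENNReal) ^ j)
      (by rw [hN]; exact ENNReal.pow_pos (by simp) j)
    obtain ⟨𝒰, h𝒰, rfl⟩ := (TopologicalSpace.isBasis_countableBasis α).open_eq_sUnion hUo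
    have h𝒰c : (insert ∅ 𝒰).Countable :=
      ((TopologicalSpace.countable_countableBasis α).mono h𝒰).insert _
    obtain ⟨u, hu⟩ := h𝒰c.exists_eq_range (Set.insert_nonempty _ _)
    have huA : ∀ i, u i ∈ 𝒜 := by
      intro i
      have : u i ∈ insert ∅ 𝒰 := hu ▸ Set.mem_range_self i
      rcases this with h | h
      · rw [h]; exact hA.empty_mem
      · exact self_subset_generateSetAlgebra (h𝒰 h)
    have hun : ⋃₀ 𝒰 = ⋃ i, disjointed u i := by
      rw [iUnion_disjointed, ← Set.sUnion_range, ← hu, Set.sUnion_insert, Set.empty_union]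
    have hdA : ∀ i, disjointed u i ∈ 𝒜 := hA.isSetRing.disjointed_mem huA
    refine ⟨disjointed u, hdA, hun ▸ hNU, ?_⟩
    rw [← measure_iUnion (disjoint_disjointed u) fun i => hmeas _ (hdA i), ← hun]
    exact hUj.le
  choose D hDA hND hDμ using hU
  let J : ℕ → Set α := fun m => D m.unpair.1 m.unpair.2
  have hJ : ∑' m, μ (J m) ≠ ⊤ := by
    have h1 : ∑' m, μ (J m) = ∑' p : ℕ × ℕ, μ (D p.1 p.2) :=
      Nat.pairEquiv.symm.tsum_eq fun p : ℕ × ℕ => μ (D p.1 p.2)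
    rw [h1, ENNReal.tsum_prod (f := fun a b => μ (D a b))]
    refine ne_top_of_le_ne_top ?_ (ENNReal.tsum_le_tsum hDμ)
    rw [ENNReal.tsum_geometric]
    simp
  obtain ⟨φ, hφ, hφδ⟩ := extraction_forall_of_eventually
    (P := fun k n => ∑' m, μ (J (m + n)) ≤ δ k) fun k =>
      ((ENNReal.tendsto_sum_nat_add _ hJ).eventually_lt_const (hδ k)).mono fun _ h => h.le
  refine ⟨fun k => ⋃ m ∈ Finset.Ico (φ k) (φ (k + 1)), J m, fun k => ⟨?_, ?_⟩, fun x hx => ?_⟩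
  · exact hA.biUnion_mem _ fun m _ => hDA _ _
  · refine (measure_biUnion_finset_le _ _).trans (le_trans ?_ (hφδ k))
    rw [Finset.sum_Ico_eq_sum_range]
    simp_rw [add_comm (φ k)]
    exact ENNReal.sum_le_tsum _
  · rw [frequently_atTop]
    intro K
    -- The cover of level `φ K` places `x` in a set of index at least `φ K`, hence in a block
    -- numbered at least `K`.
    obtain ⟨i, hi⟩ := Set.mem_iUnion.1 (hND (φ K) hx)
    have hm : φ K ≤ Nat.pair (φ K) i := Nat.left_le_pair _ _
    have hex : ∃ k, Nat.pair (φ K) i < φ k :=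
      ⟨_, (Nat.lt_succ_self _).trans_le (hφ.id_le _)⟩
    classical
    have hlt := Nat.find_spec hex
    have hKlt : K < Nat.find hex := hφ.lt_iff_lt.1 (hm.trans_lt hlt)
    obtain ⟨k, hk⟩ : ∃ k, Nat.find hex = k + 1 := ⟨_, (Nat.succ_pred (by omega)).symm⟩
    refine ⟨k, by omega, Set.mem_biUnion (x := Nat.pair (φ K) i) ?_ ?_⟩
    · refine Finset.mem_coe.2 (Finset.mem_Ico.2 ⟨?_, hk ▸ hlt⟩)
      exact not_lt.1 (Nat.find_min hex (by omega))
    · simpa [J] using hi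

open MeasureTheory in
theorem SlalomCapture.measure_iUnion_eq_zero (hS : SlalomCapture) {α : Type*}
    [TopologicalSpace α] [SecondCountableTopology α] [MeasurableSpace α]
    [OpensMeasurableSpace α] (μ : Measure α) [μ.OuterRegular] {ι : Type} (hι : #ι ≤ ℵ₁)
    {N : ι → Set α} (hN : ∀ i, μ (N i) = 0) : μ (⋃ i, N i) = 0 := by
  classical
  set 𝒜 := generateSetAlgebra (TopologicalSpace.countableBasis α) with h𝒜
  have hAc : 𝒜.Countable :=
    countable_generateSetAlgebra (TopologicalSpace.countable_countableBasis α)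
  obtain ⟨e, he⟩ := hAc.exists_eq_range ⟨∅, isSetAlgebra_generateSetAlgebra.empty_mem⟩
  -- The rate `8⁻¹` keeps the measures summable after multiplication by the slalom width `4 ^ (k +
  -- 1)`.
  let δ : ℕ → ENNReal := fun k => (8⁻¹ : ENNReal) ^ k
  have hδ : ∀ k, 0 < δ k := fun k => ENNReal.pow_pos (by simp) k
  have hC := fun i => exists_small_cover_of_measure_zero μ (hN i) hδ
  choose C hCA hCN using hC
  have hcode : ∀ i k, ∃ c, e c = C i k := fun i k => by
    have : C i k ∈ Set.range e := he ▸ (hCA i k).1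
    exact this
  choose c hc using hcode
  obtain ⟨S, hScard, hSc⟩ := hS hι c
  -- The slalom may also contain codes of large sets; the filter discards them.
  let E : ℕ → Set α := fun k => ⋃ m ∈ (S k).filter fun m => μ (e m) ≤ δ k, e m
  have hE : ∀ k, μ (E k) ≤ 4 * 2⁻¹ ^ k := by
    intro k
    calc μ (E k) ≤ ∑ m ∈ (S k).filter fun m => μ (e m) ≤ δ k, μ (e m) :=
          measure_biUnion_finset_le _ _
      _ ≤ ∑ m ∈ (S k).filter fun m => μ (e m) ≤ δ k, δ k :=
          Finset.sum_le_sum fun m hm => (Finset.mem_filter.1 hm).2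
      _ = ((S k).filter fun m => μ (e m) ≤ δ k).card * δ k := by simp
      _ ≤ (4 ^ (k + 1) : ℕ) * δ k := by
          gcongr
          exact (Finset.card_filter_le _ _).trans (hScard k)
      _ = 4 * 2⁻¹ ^ k := by
          have : (4 : ENNReal) * 8⁻¹ = 2⁻¹ := by
            rw [show (8 : ENNReal) = 4 * 2 by norm_num,
              ENNReal.mul_inv (by simp) (by simp), ← mul_assoc,
              ENNReal.mul_inv_cancel (by simp) (by simp), one_mul]
          rw [← this, mul_pow]
          push_cast
          ring
  refine measure_mono_null ?_ (measure_limsup_atTop_eq_zero (μ := μ) (s := E) ?_)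
  · refine Set.iUnion_subset fun i x hx => ?_
    rw [mem_limsup_iff_frequently_mem]
    refine ((hCN i x hx).and_eventually (hSc i)).mono fun k hk => ?_
    refine Set.mem_biUnion (x := c i k) ?_ ((hc i k).symm ▸ hk.1)
    exact Finset.mem_coe.2 (Finset.mem_filter.2 ⟨hk.2, (hc i k).symm ▸ (hCA i k).2⟩)
  · refine ne_top_of_le_ne_top ?_ (ENNReal.tsum_le_tsum hE)
    rw [ENNReal.tsum_mul_left, ENNReal.tsum_geometric]
    exact ENNReal.mul_ne_top (by simp) (by simp)

instance : MeasureTheory.IsProbabilityMeasure cantorMeasure := by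
  unfold cantorMeasure; infer_instance

open MeasureTheory in
theorem cantorMeasure_image_add_left (a : CantorSpc) {N : Set CantorSpc}
    (hN : cantorMeasure N = 0) : cantorMeasure ((fun x => a + x) '' N) = 0 := by
  have hmap : cantorMeasure.map (fun x : CantorSpc => -a + x) = cantorMeasure := by
    unfold cantorMeasure
    have h := Measure.infinitePi_map_pi
      (μ := fun _ : ℕ => ProbabilityTheory.uniformOn (Set.univ : Set (Fin 2)))
      (f := fun n (v : Fin 2) => -a n + v) (fun n => measurable_of_finite _)
    refine h.trans ?_
    congr 1
    funext n
    ext s -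
    rw [Measure.map_apply (measurable_of_finite _) s.toFinite.measurableSet,
      ProbabilityTheory.uniformOn_univ, ProbabilityTheory.uniformOn_univ, Measure.count_apply,
      Measure.count_apply, Set.encard_preimage_of_bijective (AddGroup.addLeft_bijective (-a n))]
    exacts [s.toFinite.measurableSet, (Set.toFinite _).measurableSet]
  have himg : (fun x => a + x) '' N = (fun x => -a + x) ⁻¹' N := by
    rw [← Set.image_add_left]
  rw [himg]
  have hm : Measurable fun x : CantorSpc => -a + x := by
    refine measurable_pi_lambda _ fun n => ?_
    exact (measurable_of_finite fun v : Fin 2 => -a n + v).comp (measurable_pi_apply n)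
  -- This inequality holds for arbitrary `N`, which need not be measurable.
  have hle := Measure.le_map_apply hm.aemeasurable (μ := cantorMeasure) N
  rw [hmap, hN] at hle
  exact le_antisymm hle bot_le

theorem SlalomCapture.isNullAdditive (hS : SlalomCapture) {A : Set CantorSpc} (hA : #A ≤ ℵ₁) :
    IsNullAdditive A := by
  intro N hN
  rw [← Set.iUnion_add_left_image, Set.biUnion_eq_iUnion]
  exact hS.measure_iUnion_eq_zero cantorMeasure hA fun a => cantorMeasure_image_add_left a hN

/-! ### Slalom capture from Lipschitz covers -/

/-- Every family of at most `ℵ₁` functions is bounded for eventual domination. -/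
def AlephOneBounded : Prop :=
  ∀ {ι : Type}, #ι ≤ ℵ₁ → ∀ f : ι → ℕ → ℕ, ∃ g : ℕ → ℕ, ∀ i, ∀ᶠ n in atTop, f i n ≤ g n

theorem SlalomCapture.alephOneBounded (hS : SlalomCapture) : AlephOneBounded := by
  intro ι hι f
  obtain ⟨S, -, hS⟩ := hS hι f
  exact ⟨fun n => (S n).sup id, fun i => (hS i).mono fun n hn => Finset.le_sup (f := id) hn⟩

theorem LipCover.slalomCapture (h : LipCover ℕ) : SlalomCapture := by
  classical
  intro ι hι f
  obtain ⟨S, hS, hf⟩ := h.exists_prefix_slalom hι f strictMono_id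
  refine ⟨fun n => (S (n + 1)).image fun s => s n,
    fun n => Finset.card_image_le.trans (hS _), fun i => ?_⟩
  filter_upwards [(tendsto_add_atTop_nat 1).eventually (hf i)] with n ⟨s, hs, hsn⟩
  exact Finset.mem_image.2 ⟨s, hs, hsn n (Nat.lt_succ_self n)⟩

/-- Where `f i n ≤ g n`, the value is coded by a single `1` in a block of length `g n + 1` starting
at `P n`, so prefixes of length `P (n + 1)` reveal it as the position of the first `1`. -/
theorem LipCover.slalomCapture_of_bounded (h : LipCover (Fin 2)) (hb : AlephOneBounded) :
    SlalomCapture := by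
  classical
  intro ι hι f
  obtain ⟨g, hg⟩ := hb hι f
  let P : ℕ → ℕ := fun n => ∑ k ∈ Finset.range n, (g k + 1)
  have hPs : ∀ n, P (n + 1) = P n + (g n + 1) := fun n => Finset.sum_range_succ _ _
  have hP : StrictMono P := strictMono_nat_of_lt_succ fun n => by rw [hPs]; omega
  let b : ι → ℕ → Fin 2 := fun i m => if ∃ n, f i n ≤ g n ∧ m = P n + f i n then 1 else 0
  have hb1 : ∀ i n v, f i n ≤ g n → v ≤ f i n → (b i (P n + v) = 1 ↔ v = f i n) := by
    intro i n v hn hv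
    have : (∃ n', f i n' ≤ g n' ∧ P n + v = P n' + f i n') ↔ v = f i n := by
      refine ⟨fun ⟨n', hn', hv'⟩ => ?_, fun h => ⟨n, hn, by rw [h]⟩⟩
      rcases lt_trichotomy n n' with hlt | rfl | hlt
      · have h1 := hP.monotone (show n + 1 ≤ n' from hlt)
        rw [hPs] at h1
        omega
      · omega
      · have h1 := hP.monotone (show n' + 1 ≤ n from hlt)
        rw [hPs] at h1
        omega
    rw [← this]
    simp [b]
  obtain ⟨S, hS, hc⟩ := h.exists_prefix_slalom hι b hP
  refine ⟨fun n => (S (n + 1)).image fun s => sInf {v | s (P n + v) = 1},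
    fun n => Finset.card_image_le.trans (hS _), fun i => ?_⟩
  filter_upwards [(tendsto_add_atTop_nat 1).eventually (hc i), hg i] with n ⟨s, hs, hsn⟩ hgn
  refine Finset.mem_image.2 ⟨s, hs, ?_⟩
  have hmem : ∀ v ≤ f i n, (s (P n + v) = 1 ↔ v = f i n) := fun v hv => by
    rw [hsn _ (by rw [hPs]; omega), hb1 i n v hgn hv]
  have h1 : f i n ∈ {v | s (P n + v) = 1} := (hmem _ le_rfl).2 rfl
  have h2 := Nat.sInf_mem ⟨_, h1⟩
  exact (hmem _ (Nat.sInf_le h1)).1 h2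

/-! ### Boundedness from Lipschitz covers of Cantor space -/

theorem exists_strictMono_bound {C : Set (ℕ → ℕ)} (hC : C.Countable) :
    ∃ g : ℕ → ℕ, StrictMono g ∧ ∀ f ∈ C, ∀ᶠ n in atTop, f n ≤ g n := by
  obtain ⟨c, hc⟩ := (hC.insert (0 : ℕ → ℕ)).exists_eq_range (Set.insert_nonempty _ _)
  let u : ℕ → ℕ := fun n => ∑ k ∈ Finset.range (n + 1), c k n
  refine ⟨fun n => ∑ m ∈ Finset.range (n + 1), (u m + 1), strictMono_nat_of_lt_succ fun n => ?_,
    fun f hf => ?_⟩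
  · rw [Finset.sum_range_succ _ (n + 1)]
    omega
  · obtain ⟨k, rfl⟩ : f ∈ Set.range c := hc ▸ Set.mem_insert_of_mem _ hf
    filter_upwards [eventually_ge_atTop k] with n hn
    calc c k n ≤ u n := Finset.single_le_sum (f := fun k => c k n) (fun _ _ => Nat.zero_le _)
          (Finset.mem_range.2 (by omega))
      _ ≤ u n + 1 := Nat.le_succ _
      _ ≤ _ := Finset.single_le_sum (f := fun m => u m + 1) (fun _ _ => Nat.zero_le _)
          (Finset.mem_range.2 (by omega))

/-- Recursion along `ω₁`: `F w` dominates all earlier stages and the `w`-th member of an unbounded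
family. If `g` does not dominate member `w₀`, it dominates no `F w` with `w ≥ w₀`. -/
theorem exists_unbounded_chain (h : ¬ AlephOneBounded) :
    ∃ (W : Type) (F : W → ℕ → ℕ), #W = ℵ₁ ∧ (∀ w, StrictMono (F w)) ∧
      ∀ g : ℕ → ℕ, {w | ∀ᶠ n in atTop, F w n ≤ g n}.Countable := by
  unfold AlephOneBounded at h
  push Not at h
  obtain ⟨ι, hι, f, hf⟩ := h
  let W : Type := (ℵ₁ : Cardinal.{0}).ord.ToType
  have hW : #W = ℵ₁ := mk_ord_toType _
  have hWc : ∀ w : W, (Set.Iio w).Countable := fun w => by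
    rw [← le_aleph0_iff_set_countable, ← not_lt, ← aleph_one_le_iff, not_le]
    exact (mk_Iio_lt w (by rw [hW]; exact (Ordinal.type_toType _).symm)).trans_eq hW
  have : Nonempty ι := ⟨(hf 0).choose⟩
  obtain ⟨j⟩ : Nonempty (ι ↪ W) := by rwa [← hW] at hι
  let e : W → ι := Function.invFun j
  have he : Function.Surjective e := Function.invFun_surjective j.injective
  have hstep : ∀ (w : W) (ih : ∀ v, v < w → ℕ → ℕ), ∃ g : ℕ → ℕ, StrictMono g ∧
      (∀ᶠ n in atTop, f (e w) n ≤ g n) ∧ ∀ v hv, ∀ᶠ n in atTop, ih v hv n ≤ g n := by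
    intro w ih
    have := (hWc w).to_subtype
    obtain ⟨g, hg, hb⟩ := exists_strictMono_bound
      ((Set.countable_range fun v : Set.Iio w => ih v v.2).insert (f (e w)))
    exact ⟨g, hg, hb _ (Set.mem_insert _ _),
      fun v hv => hb _ (Set.mem_insert_of_mem _ ⟨⟨v, hv⟩, rfl⟩)⟩
  choose G hG using hstep
  let F : W → ℕ → ℕ := (wellFounded_lt (α := W)).fix G
  have hF : ∀ w, F w = G w fun v _ => F v := fun w => WellFounded.fix_eq _ _ _
  refine ⟨W, F, hW, fun w => hF w ▸ (hG w _).1, fun g => ?_⟩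
  obtain ⟨i, hi⟩ := hf g
  obtain ⟨w₀, rfl⟩ := he i
  refine (hWc w₀).mono fun w hw => ?_
  by_contra hlt
  refine hi ?_
  have h0 : ∀ᶠ n in atTop, f (e w₀) n ≤ F w₀ n := hF w₀ ▸ (hG w₀ _).2.1
  have h1 : ∀ᶠ n in atTop, F w₀ n ≤ F w n := by
    rcases (not_lt.1 (show ¬ w < w₀ from hlt)).eq_or_lt with rfl | hlt
    · exact Eventually.of_forall fun _ => le_rfl
    · have := (hG w fun v _ => F v).2.2 w₀ hlt
      rwa [← hF w] at this
  filter_upwards [h0, h1, hw] with n a b c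
  exact not_lt.2 ((a.trans b).trans c)

/-- The characteristic function of the range of `f`. -/
noncomputable def rangeIndicator (f : ℕ → ℕ) : ℕ → Fin 2 :=
  (Set.range f).indicator 1

theorem rangeIndicator_ne_zero_iff {f : ℕ → ℕ} {n : ℕ} :
    rangeIndicator f n ≠ 0 ↔ n ∈ Set.range f := by
  simp [rangeIndicator]

/-- A set of sparse sequences indexed by an unbounded chain is concentrated on the eventually zero
sequences, so a fibre of a continuous map omitting those is countable. -/
theorem countable_fibre_of_chain {W : Type} {F : W → ℕ → ℕ} (hF : ∀ w, StrictMono (F w))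
    (hFc : ∀ g : ℕ → ℕ, {w | ∀ᶠ n in atTop, F w n ≤ g n}.Countable)
    {f : CantorSpc → CantorSpc} (hf : IsLip f) {x : CantorSpc}
    (hx : ∀ q : CantorSpc, (∀ᶠ n in atTop, q n = 0) → ∃ k, f q (2 * k) ≠ x k) :
    {a ∈ tailClosure (Set.range fun w => rangeIndicator (F w)) |
      ∀ k, f a (2 * k) = x k}.Countable := by
  have hG : ∀ m, ∃ M, ∀ a : CantorSpc, (∀ k, f a (2 * k) = x k) →
      ∃ n, m ≤ n ∧ n < M ∧ a n ≠ 0 := by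
    intro m
    -- Only finitely many words of length `m` exist, and the image of each one's zero extension
    -- misses `x` at some index. A point of the fibre must therefore leave its own zero extension
    -- before a uniform bound `M`.
    let q : (Fin m → Fin 2) → CantorSpc := fun l n => if h : n < m then l ⟨n, h⟩ else 0
    have hq : ∀ l, ∃ k, f (q l) (2 * k) ≠ x k := fun l =>
      hx _ ((eventually_ge_atTop m).mono fun n hn => by simp [q, not_lt.2 hn])
    choose K hK using hq
    refine ⟨Finset.univ.sup fun l => 2 * K l + 1, fun a ha => ?_⟩
    by_contra! hc
    let l : Fin m → Fin 2 := fun i => a i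
    refine hK l ?_
    rw [← ha]
    refine hf.agree (n := 2 * K l + 1) (fun n hn => ?_) _ (Nat.lt_succ_self _)
    by_cases hnm : n < m
    · simp [q, hnm, l]
    · have := hc n (not_lt.1 hnm) (hn.trans_le
        (Finset.le_sup (f := fun l => 2 * K l + 1) (Finset.mem_univ l)))
      simp [q, hnm, this]
  choose G hG using hG
  let H : ℕ → ℕ := fun j => Nat.rec 0 (fun _ r => max (G r) (r + 1)) j
  have hHs : ∀ j, H (j + 1) = max (G (H j)) (H j + 1) := fun j => rfl
  have hH : StrictMono H := strictMono_nat_of_lt_succ fun j => by rw [hHs]; omega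
  have hsub : {a ∈ tailClosure (Set.range fun w => rangeIndicator (F w)) |
      ∀ k, f a (2 * k) = x k} ⊆
      ⋃ w ∈ {w | ∀ᶠ n in atTop, F w n ≤ H (2 * n + 1)},
        {a | ∀ᶠ n in atTop, a n = rangeIndicator (F w) n} := by
    rintro a ⟨⟨_, ⟨w, rfl⟩, haw⟩, ha⟩
    refine Set.mem_biUnion (x := w) ?_ haw
    obtain ⟨m, hm⟩ := eventually_atTop.1 haw
    have hmeet : ∀ j, m ≤ j → ∃ i, H j ≤ F w i ∧ F w i < H (j + 1) := by
      intro j hj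
      obtain ⟨n, hn1, hn2, hn3⟩ := hG (H j) a ha
      rw [hm n (hj.trans ((hH.id_le j).trans hn1)), rangeIndicator_ne_zero_iff] at hn3
      obtain ⟨i, rfl⟩ := hn3
      exact ⟨i, hn1, hn2.trans_le (by rw [hHs]; exact le_max_left _ _)⟩
    have hmeet' : ∀ k, ∃ i, H (m + k) ≤ F w i ∧ F w i < H (m + k + 1) := fun k =>
      hmeet _ (Nat.le_add_right _ _)
    choose i hi1 hi2 using hmeet'
    have hi : StrictMono i := strictMono_nat_of_lt_succ fun k =>
      (hF w).lt_iff_lt.1 ((hi2 k).trans_le (hi1 (k + 1)))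
    filter_upwards [eventually_ge_atTop m] with k hk
    calc F w k ≤ F w (i k) := (hF w).monotone (hi.id_le k)
      _ ≤ H (m + k + 1) := (hi2 k).le
      -- Doubling the index absorbs the threshold `m`, so one bound serves the whole fibre.
      _ ≤ H (2 * k + 1) := hH.monotone (show m + k + 1 ≤ 2 * k + 1 by omega)
  exact ((hFc _).biUnion fun w _ => countable_eventuallyEq _).mono hsub

/-- Interleave two sequences. -/
def interleave (x y : CantorSpc) : CantorSpc :=
  fun n => if n % 2 = 0 then x (n / 2) else y (n / 2)

theorem interleave_even (x y : CantorSpc) (k : ℕ) : interleave x y (2 * k) = x k := by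
  simp [interleave]

theorem interleave_odd (x y : CantorSpc) (k : ℕ) : interleave x y (2 * k + 1) = y k := by
  have h1 : (2 * k + 1) % 2 = 1 := by omega
  have h2 : (2 * k + 1) / 2 = k := by omega
  simp [interleave, h1, h2]

theorem interleave_injective (x : CantorSpc) : Function.Injective (interleave x) := by
  intro y z h
  ext1 k
  rw [← interleave_odd x y, h, interleave_odd]

theorem LipCover.alephOneBounded (h : LipCover (Fin 2)) : AlephOneBounded := by
  by_contra hb
  obtain ⟨W, F, hW, hF, hFc⟩ := exists_unbounded_chain hb
  have hcard : #(Set.range fun w => rangeIndicator (F w)) = ℵ₁ := by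
    apply le_antisymm (mk_range_le.trans hW.le)
    rw [aleph_one_le_iff]
    by_contra! hc
    rw [le_aleph0_iff_set_countable] at hc
    have hu : (Set.univ : Set W) ⊆ ⋃ t ∈ Set.range fun w => rangeIndicator (F w),
        {w | rangeIndicator (F w) = t} := fun w _ => Set.mem_biUnion ⟨w, rfl⟩ rfl
    have hcu : (Set.univ : Set W).Countable := by
      refine (hc.biUnion ?_).mono hu
      rintro _ ⟨v, rfl⟩
      refine (hFc (F v)).mono fun w hw => Eventually.of_forall fun n => ?_
      have hr : Set.range (F w) = Set.range (F v) := by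
        ext n
        rw [← rangeIndicator_ne_zero_iff, ← rangeIndicator_ne_zero_iff]
        exact not_congr (by rw [show rangeIndicator (F w) = rangeIndicator (F v) from hw])
      rw [((hF w).range_inj (hF v)).1 hr]
    rw [← le_aleph0_iff_set_countable, mk_univ, hW] at hcu
    exact absurd hcu (not_le.2 aleph0_lt_aleph_one)
  obtain ⟨Y, hY⟩ := (le_mk_iff_exists_set (c := ℵ₁)).1 (aleph_one_le_mk_seq (Fin 2))
  have hYc : ¬ Y.Countable := by
    rw [← le_aleph0_iff_set_countable, hY]
    exact not_le.2 aleph0_lt_aleph_one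
  obtain ⟨T, hT, hYT⟩ := exists_mk_eq_aleph_one_superset (ι := Y × Y)
    (by simp [hY])
    fun p => interleave p.1 p.2
  obtain ⟨f, hf, hcov⟩ := h _ _ (isAlephOneDense_tailClosure hcard) (isAlephOneDense_tailClosure hT)
  -- These are the even parts of images of eventually zero sequences. Any `x ∈ Y` outside them has
  -- countable fibres, yet the fibres must cover `interleave x '' Y`.
  have hE : (⋃ m, (fun q : CantorSpc => fun k => f m q (2 * k)) ''
      {q | ∀ᶠ n in atTop, q n = (0 : CantorSpc) n}).Countable :=
    Set.countable_iUnion fun m => (countable_eventuallyEq _).image _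
  obtain ⟨x, hxY, hxE⟩ : ∃ x ∈ Y, x ∉ ⋃ m, (fun q : CantorSpc => fun k => f m q (2 * k)) ''
      {q | ∀ᶠ n in atTop, q n = (0 : CantorSpc) n} := by
    by_contra! hc
    exact hYc (hE.mono hc)
  have hfib := fun m => countable_fibre_of_chain hF hFc (hf m) (x := x) fun q hq => by
    by_contra! hc
    exact hxE (Set.mem_iUnion.2 ⟨m, q, hq, funext hc⟩)
  have hsub : interleave x '' Y ⊆ ⋃ m, f m ''
      {a ∈ tailClosure (Set.range fun w => rangeIndicator (F w)) |
        ∀ k, f m a (2 * k) = x k} := by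
    rintro _ ⟨y, hy, rfl⟩
    obtain ⟨m, a, ha, hay⟩ :=
      Set.mem_iUnion.1 (hcov (subset_tailClosure T (hYT (⟨x, hxY⟩, ⟨y, hy⟩))))
    refine Set.mem_iUnion.2 ⟨m, a, ⟨ha, fun k => ?_⟩, hay⟩
    rw [hay, interleave_even]
  have := (Set.countable_iUnion fun m => (hfib m).image (f m)).mono hsub
  exact hYc (Set.countable_of_injective_of_countable_image (interleave_injective x).injOn this)

theorem slalomCapture_of_strongBALip (h : StrongBALipCantor ∨ StrongBALipBaire) :
    SlalomCapture :=
  h.elim (fun h => h.lipCover.slalomCapture_of_bounded h.lipCover.alephOneBounded)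
    fun h => h.lipCover.slalomCapture

/-! ### Meagre sets from slaloms -/

/-- A diagonal argument: the slalom captures whole blocks of `4 ^ (n + 1)` values, and `g` copies
the `j`-th entry of the `j`-th candidate. Whichever candidate is correct, one agreement results. -/
theorem SlalomCapture.exists_frequently_eq (hS : SlalomCapture) {ι : Type} (hι : #ι ≤ ℵ₁)
    (f : ι → ℕ → ℕ) : ∃ g : ℕ → ℕ, ∀ i, ∃ᶠ n in atTop, g n = f i n := by
  obtain ⟨S, hcard, hmem⟩ := hS hι fun i n =>
    Encodable.encode (List.ofFn fun j : Fin (4 ^ (n + 1)) => f i (Nat.pair n j))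
  let g : ℕ → ℕ := fun m =>
    (((Encodable.decode ((S m.unpair.1).toList.getD m.unpair.2 0) : Option (List ℕ)).getD
      []).getD m.unpair.2 0)
  refine ⟨g, fun i => frequently_atTop.2 fun N => ?_⟩
  obtain ⟨n, hn, hNn⟩ := ((hmem i).and (eventually_ge_atTop N)).exists
  obtain ⟨j, hj, hjn⟩ := List.getElem_of_mem (Finset.mem_toList.2 hn)
  have hj4 : j < 4 ^ (n + 1) := by
    rw [Finset.length_toList] at hj
    exact hj.trans_le (hcard n)
  refine ⟨Nat.pair n j, hNn.trans (Nat.left_le_pair n j), ?_⟩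
  have : (S n).toList.getD j 0 =
      Encodable.encode (List.ofFn fun j : Fin (4 ^ (n + 1)) => f i (Nat.pair n j)) := by
    rw [List.getD_eq_getElem _ _ hj, hjn]
  simp only [g, Nat.unpair_pair, this, Encodable.encodek, Option.getD_some]
  rw [List.getD_eq_getElem _ _ (by simpa using hj4), List.getElem_ofFn]

/-- Nested closed intervals with rational endpoints can be steered away from any `ℵ₁` closed
nowhere dense sets of reals. -/
theorem SlalomCapture.exists_notMem_of_isNowhereDense (hS : SlalomCapture) {ι : Type}
    (hι : #ι ≤ ℵ₁) {K : ι → Set ℝ} (hK : ∀ i, IsClosed (K i) ∧ IsNowhereDense (K i)) :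
    ∃ x, ∀ i, x ∉ K i := by
  have : Nonempty {p : ℚ × ℚ // p.1 < p.2} := ⟨⟨(0, 1), by norm_num⟩⟩
  obtain ⟨e, he⟩ := exists_surjective_nat {p : ℚ × ℚ // p.1 < p.2}
  let I : ℕ → Set ℝ := fun n => Set.Icc ((e n).1.1 : ℝ) ((e n).1.2 : ℝ)
  have hstep : ∀ i m, ∃ j, I j ⊆ I m ∧ Disjoint (I j) (K i) := by
    intro i m
    have hab : ((e m).1.1 : ℝ) < (e m).1.2 := by exact_mod_cast (e m).2
    have hne : (Set.Ioo ((e m).1.1 : ℝ) (e m).1.2 \ K i).Nonempty := by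
      by_contra hc
      rw [Set.not_nonempty_iff_eq_empty, Set.sdiff_eq_empty] at hc
      have h1 := interior_maximal hc isOpen_Ioo
      have h2 : interior (K i) = ∅ := by
        have := (hK i).2
        rwa [IsNowhereDense, (hK i).1.closure_eq] at this
      rw [h2] at h1
      exact (Set.nonempty_Ioo.2 hab).not_subset_empty h1
    obtain ⟨x, hx⟩ := hne
    obtain ⟨l, u, ⟨hl, hu⟩, hlu⟩ :=
      mem_nhds_iff_exists_Ioo_subset.1 ((isOpen_Ioo.sdiff (hK i).1).mem_nhds hx)
    obtain ⟨p, hp1, hp2⟩ := exists_rat_btwn hl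
    obtain ⟨q, hq1, hq2⟩ := exists_rat_btwn hu
    obtain ⟨j, hj⟩ := he ⟨(p, q), by exact_mod_cast hp2.trans hq1⟩
    have hsub : I j ⊆ Set.Ioo ((e m).1.1 : ℝ) (e m).1.2 \ K i := by
      simp only [I, hj]
      exact (Set.Icc_subset_Ioo hp1 hq2).trans hlu
    exact ⟨j, fun y hy => Set.Ioo_subset_Icc_self (hsub hy).1,
      Set.disjoint_left.2 fun y hy => (hsub hy).2⟩
  choose h hI hd using hstep
  obtain ⟨b, hb⟩ := hS.alephOneBounded hι fun i n => (Finset.range (n + 1)).sup (h i)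
  -- Intervals with index at most `N n` have responses of index at most `N (n + 1)` whenever `b`
  -- bounds at `N n`. A finite table of responses on indices up to `N n` can thus be guessed without
  -- knowing `p n`.
  let N : ℕ → ℕ := fun n => Nat.rec 0 (fun _ r => max (b r) (r + 1)) n
  have hNs : ∀ n, N (n + 1) = max (b (N n)) (N n + 1) := fun n => rfl
  have hN : StrictMono N := strictMono_nat_of_lt_succ fun n => by rw [hNs]; omega
  obtain ⟨g, hg⟩ := hS.exists_frequently_eq hι fun i n =>
    Encodable.encode (List.ofFn fun m : Fin (N n + 1) => h i m)
  let guess : ℕ → ℕ → ℕ := fun n m =>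
    ((Encodable.decode (g n) : Option (List ℕ)).getD []).getD m 0
  classical
  -- An illegal guess leaves the interval unchanged; a correct one, made after `b` dominates, avoids
  -- `K i`.
  let p : ℕ → ℕ := fun n => Nat.rec 0 (fun n r =>
    if I (guess n r) ⊆ I r ∧ guess n r ≤ N (n + 1) then guess n r else r) n
  have hps : ∀ n, p (n + 1) = if I (guess n (p n)) ⊆ I (p n) ∧ guess n (p n) ≤ N (n + 1)
    then guess n (p n) else p n := fun n => rfl
  have hpN : ∀ n, p n ≤ N n := by
    intro n
    induction n with
    | zero => exact le_rfl
    | succ n ih =>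
      rw [hps]
      split_ifs with hc
      · exact hc.2
      · exact ih.trans (hN.monotone (Nat.le_succ n))
  have hpI : ∀ n, I (p (n + 1)) ⊆ I (p n) := by
    intro n
    rw [hps]
    split_ifs with hc
    · exact hc.1
    · exact subset_rfl
  obtain ⟨x, hx⟩ := IsCompact.nonempty_iInter_of_sequence_nonempty_isCompact_isClosed
    (fun n => I (p n)) hpI
    (fun n => Set.nonempty_Icc.2 (by exact_mod_cast (e (p n)).2.le))
    isCompact_Icc fun n => isClosed_Icc
  refine ⟨x, fun i hxi => ?_⟩
  obtain ⟨n, hn, hbn⟩ := ((hg i).and_eventually (hN.tendsto_atTop.eventually (hb i))).exists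
  have hguess : guess n (p n) = h i (p n) := by
    have hlt : p n < N n + 1 := Nat.lt_succ_of_le (hpN n)
    simp only [guess, hn, Encodable.encodek, Option.getD_some]
    rw [List.getD_eq_getElem _ _ (by simpa using hlt), List.getElem_ofFn]
  have hle : h i (p n) ≤ N (n + 1) := by
    rw [hNs]
    refine le_max_of_le_left (le_trans ?_ hbn)
    exact Finset.le_sup (f := h i) (Finset.mem_range.2 (Nat.lt_succ_of_le (hpN n)))
  have hpn : p (n + 1) = h i (p n) := by
    rw [hps, hguess, if_pos ⟨hI i _, hle⟩]
  have hxn : x ∈ I (p (n + 1)) := Set.mem_iInter.1 hx (n + 1)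
  rw [hpn] at hxn
  exact Set.disjoint_left.1 (hd i _) hxn hxi

theorem exists_closed_cover_of_isMeagre {M : Set ℝ} (hM : IsMeagre M) :
    ∃ K : ℕ → Set ℝ, (∀ n, IsClosed (K n) ∧ IsNowhereDense (K n)) ∧ M ⊆ ⋃ n, K n := by
  obtain ⟨S, hS, hSc, hMS⟩ := isMeagre_iff_countable_union_isNowhereDense.1 hM
  obtain ⟨u, hu⟩ := (hSc.insert ∅).exists_eq_range (Set.insert_nonempty _ _)
  refine ⟨fun n => closure (u n), fun n => ⟨isClosed_closure, IsNowhereDense.closure ?_⟩, ?_⟩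
  · have : u n ∈ insert ∅ S := hu ▸ Set.mem_range_self n
    rcases this with h | h
    · rw [h]; exact isNowhereDense_empty
    · exact hS _ h
  · intro x hx
    obtain ⟨t, ht, hxt⟩ := hMS hx
    obtain ⟨n, rfl⟩ : t ∈ Set.range u := hu ▸ Set.mem_insert_of_mem _ ht
    exact Set.mem_iUnion.2 ⟨n, subset_closure hxt⟩

/-- Avoiding all rational translates gives a dense set `z + ℚ` disjoint from every `K i n`. A common
eventual bound on the reciprocal radii of avoiding balls then produces one dense `Gδ` disjoint from
the union. -/
theorem SlalomCapture.isMeagre_iUnion (hS : SlalomCapture) {ι : Type} (hι : #ι ≤ ℵ₁)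
    {M : ι → Set ℝ} (hM : ∀ i, IsMeagre (M i)) : IsMeagre (⋃ i, M i) := by
  choose K hK hMK using fun i => exists_closed_cover_of_isMeagre (hM i)
  have hcard : #(ι × ℕ × ℚ) ≤ ℵ₁ := by
    rw [mk_prod, lift_uzero, lift_uzero]
    calc #ι * #(ℕ × ℚ) ≤ ℵ₁ * ℵ₁ := mul_le_mul' hι (mk_le_aleph0.trans (aleph0_le_aleph 1))
      _ = ℵ₁ := mul_eq_self (aleph0_le_aleph 1)
  obtain ⟨z, hz⟩ := hS.exists_notMem_of_isNowhereDense hcard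
    (K := fun t => (Homeomorph.addRight (t.2.2 : ℝ)) ⁻¹' K t.1 t.2.1) fun t =>
      ⟨(hK _ _).1.preimage (Homeomorph.continuous _), by
        have h := (hK t.1 t.2.1).2
        rw [IsNowhereDense] at h ⊢
        rw [← Homeomorph.preimage_closure, ← Homeomorph.preimage_interior, h, Set.preimage_empty]⟩
  obtain ⟨e, he⟩ := exists_surjective_nat ℚ
  -- Each point is listed infinitely often, which keeps every tail union `G m` dense.
  let c : ℕ → ℝ := fun k => z + e k.unpair.2
  have hr : ∀ i k, ∃ r : ℕ, ∀ n ≤ k, Disjoint (Metric.ball (c k) (1 / (r + 1))) (K i n) := by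
    intro i k
    have hcl : IsClosed (⋃ n ∈ Finset.range (k + 1), K i n) :=
      isClosed_biUnion_finset fun n _ => (hK i n).1
    have hck : c k ∈ (⋃ n ∈ Finset.range (k + 1), K i n)ᶜ := by
      intro hc
      obtain ⟨n, -, hn⟩ := Set.mem_iUnion₂.1 hc
      exact hz (i, n, e k.unpair.2) hn
    obtain ⟨ε, hε, hball⟩ := Metric.isOpen_iff.1 hcl.isOpen_compl _ hck
    obtain ⟨r, hr⟩ := exists_nat_one_div_lt hε
    refine ⟨r, fun n hn => Set.disjoint_left.2 fun y hy hyn => ?_⟩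
    exact hball (Metric.ball_subset_ball hr.le hy)
      (Set.mem_biUnion (Finset.mem_coe.2 (Finset.mem_range.2 (Nat.lt_succ_of_le hn))) hyn)
  choose r hr using hr
  obtain ⟨g, hg⟩ := hS.alephOneBounded hι r
  let G : ℕ → Set ℝ := fun m => ⋃ k ≥ m, Metric.ball (c k) (1 / (g k + 1))
  have hGo : ∀ m, IsOpen (G m) := fun m =>
    isOpen_iUnion fun k => isOpen_iUnion fun _ => Metric.isOpen_ball
  have hGd : ∀ m, Dense (G m) := by
    intro m
    rw [Metric.dense_iff]
    intro x ε hε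
    obtain ⟨q, hq1, hq2⟩ := exists_rat_btwn (show x - z - ε < x - z + ε by linarith)
    obtain ⟨j, rfl⟩ := he q
    refine ⟨z + e j, ?_, ?_⟩
    · rw [Metric.mem_ball, Real.dist_eq, abs_lt]
      constructor <;> linarith
    · refine Set.mem_biUnion (x := Nat.pair m j) (Nat.left_le_pair m j) ?_
      simp only [c, Nat.unpair_pair]
      exact Metric.mem_ball_self (by positivity)
  have hres : (⋂ m, G m) ∈ residual ℝ :=
    countable_iInter_mem.2 fun m => residual_of_dense_open (hGo m) (hGd m)
  refine mem_of_superset hres fun x hx hxM => ?_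
  obtain ⟨i, hi⟩ := Set.mem_iUnion.1 hxM
  obtain ⟨n, hn⟩ := Set.mem_iUnion.1 (hMK i hi)
  obtain ⟨m, hm⟩ := eventually_atTop.1 (hg i)
  obtain ⟨k, hk, hxk⟩ := Set.mem_iUnion₂.1 (Set.mem_iInter.1 hx (max m n))
  refine Set.disjoint_left.1 (hr i k n ((le_max_right m n).trans hk)) ?_ hn
  refine Metric.ball_subset_ball ?_ hxk
  have := hm k ((le_max_left m n).trans hk)
  gcongr

/-! ### Cardinal characteristics -/

/-- Nonemptiness matters because `sInf ∅ = 0`; each application supplies a witness family. -/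
theorem aleph_one_lt_sInf {S : Set Cardinal.{0}} (hne : S.Nonempty) (h : ∀ κ ∈ S, ¬ κ ≤ ℵ₁) :
    ℵ₁ < sInf S :=
  not_le.1 (h _ (csInf_mem hne))

section Ideal

variable {I : Set (Set ℝ)}

theorem aleph_one_lt_addChar (hadd : ∀ F ⊆ I, #F ≤ ℵ₁ → ⋃₀ F ∈ I) (hsing : ∀ x, {x} ∈ I)
    (huniv : Set.univ ∉ I) : ℵ₁ < addChar I := by
  refine aleph_one_lt_sInf ⟨_, Set.range singleton, ?_, ?_, rfl⟩ ?_
  · rintro _ ⟨x, rfl⟩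
    exact hsing x
  · rwa [Set.sUnion_range, Set.iUnion_of_singleton]
  · rintro _ ⟨F, hF, hFI, rfl⟩ hc
    exact hFI (hadd F hF hc)

theorem aleph_one_lt_covChar (hadd : ∀ F ⊆ I, #F ≤ ℵ₁ → ⋃₀ F ∈ I) (hsing : ∀ x, {x} ∈ I)
    (huniv : Set.univ ∉ I) : ℵ₁ < covChar I := by
  refine aleph_one_lt_sInf ⟨_, Set.range singleton, ?_, ?_, rfl⟩ ?_
  · rintro _ ⟨x, rfl⟩
    exact hsing x
  · rw [Set.sUnion_range, Set.iUnion_of_singleton]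
  · rintro _ ⟨F, hF, hFI, rfl⟩ hc
    exact huniv (hFI ▸ hadd F hF hc)

theorem mem_of_mk_le_aleph_one (hadd : ∀ F ⊆ I, #F ≤ ℵ₁ → ⋃₀ F ∈ I) (hsing : ∀ x, {x} ∈ I)
    {s : Set ℝ} (hs : #s ≤ ℵ₁) : s ∈ I := by
  have := hadd (singleton '' s) (by rintro _ ⟨x, -, rfl⟩; exact hsing x) (mk_image_le.trans hs)
  rwa [Set.sUnion_image, Set.biUnion_of_singleton] at this

theorem aleph_one_lt_nonChar (hadd : ∀ F ⊆ I, #F ≤ ℵ₁ → ⋃₀ F ∈ I) (hsing : ∀ x, {x} ∈ I)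
    (huniv : Set.univ ∉ I) : ℵ₁ < nonChar I := by
  refine aleph_one_lt_sInf ⟨_, Set.univ, huniv, rfl⟩ ?_
  rintro _ ⟨s, hs, rfl⟩ hc
  exact hs (mem_of_mk_le_aleph_one hadd hsing hc)

theorem aleph_one_lt_cofChar (hadd : ∀ F ⊆ I, #F ≤ ℵ₁ → ⋃₀ F ∈ I) (hsing : ∀ x, {x} ∈ I)
    (huniv : Set.univ ∉ I) : ℵ₁ < cofChar I := by
  refine aleph_one_lt_sInf ⟨_, I, subset_rfl, fun s hs => ⟨s, hs, subset_rfl⟩, rfl⟩ ?_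
  rintro _ ⟨F, hF, hcof, rfl⟩ hc
  refine huniv ?_
  -- A cofinal family covers the line, since it must absorb all singletons.
  convert hadd F hF hc
  refine (Set.eq_univ_of_forall fun x => ?_).symm
  obtain ⟨t, ht, hxt⟩ := hcof _ (hsing x)
  exact ⟨t, ht, hxt rfl⟩

end Ideal

theorem evDominatedBy_iff {f g : ℕ → ℕ} : EvDominatedBy f g ↔ ∀ᶠ n in atTop, f n ≤ g n := by
  rw [← Nat.cofinite_eq_atTop]
  rfl

theorem not_evDominatedBy_add_one (g : ℕ → ℕ) : ¬ EvDominatedBy (fun n => g n + 1) g := by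
  rw [evDominatedBy_iff]
  intro h
  obtain ⟨n, hn⟩ := h.exists
  omega

theorem AlephOneBounded.aleph_one_lt_boundingNumber (hb : AlephOneBounded) :
    ℵ₁ < boundingNumber := by
  refine aleph_one_lt_sInf ⟨_, Set.univ, ?_, rfl⟩ ?_
  · rintro ⟨g, hg⟩
    exact not_evDominatedBy_add_one g (hg _ trivial)
  · rintro _ ⟨F, hF, rfl⟩ hc
    obtain ⟨g, hg⟩ := hb hc fun f : F => f.1
    exact hF ⟨g, fun f hf => evDominatedBy_iff.2 (hg ⟨f, hf⟩)⟩

theorem AlephOneBounded.aleph_one_lt_dominatingNumber (hb : AlephOneBounded) :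
    ℵ₁ < dominatingNumber := by
  refine aleph_one_lt_sInf ⟨_, Set.univ, fun f => ⟨f, trivial, by simp [EvDominatedBy]⟩, rfl⟩ ?_
  rintro _ ⟨F, hF, rfl⟩ hc
  obtain ⟨g, hg⟩ := hb hc fun f : F => f.1
  obtain ⟨f, hf, hgf⟩ := hF fun n => g n + 1
  refine not_evDominatedBy_add_one g (evDominatedBy_iff.2 ?_)
  filter_upwards [evDominatedBy_iff.1 hgf, hg ⟨f, hf⟩] with n h1 h2
  exact h1.trans h2

theorem theorem5p3 (h : StrongBALipCantor ∨ StrongBALipBaire) :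
    (∀ A : Set CantorSpc, #A = ℵ₁ → IsNullAdditive A) ∧
    ℵ₁ < addChar nullIdeal ∧ ℵ₁ < covChar nullIdeal ∧
    ℵ₁ < nonChar nullIdeal ∧ ℵ₁ < cofChar nullIdeal ∧
    ℵ₁ < addChar meagreIdeal ∧ ℵ₁ < covChar meagreIdeal ∧
    ℵ₁ < nonChar meagreIdeal ∧ ℵ₁ < cofChar meagreIdeal ∧
    ℵ₁ < boundingNumber ∧ ℵ₁ < dominatingNumber ∧ ℵ₁ < 𝔠 := by
  have hS : SlalomCapture := slalomCapture_of_strongBALip h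
  have hb : AlephOneBounded := hS.alephOneBounded
  have hNa : ∀ F ⊆ nullIdeal, #F ≤ ℵ₁ → ⋃₀ F ∈ nullIdeal := fun F hF hc => by
    rw [Set.sUnion_eq_iUnion]
    exact hS.measure_iUnion_eq_zero _ hc fun s : F => hF s.2
  have hNs : ∀ x, {x} ∈ nullIdeal := fun x => Real.volume_singleton
  have hNu : Set.univ ∉ nullIdeal := by simp [nullIdeal]
  have hMa : ∀ F ⊆ meagreIdeal, #F ≤ ℵ₁ → ⋃₀ F ∈ meagreIdeal := fun F hF hc => by
    rw [Set.sUnion_eq_iUnion]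
    exact hS.isMeagre_iUnion hc fun s : F => hF s.2
  have hMs : ∀ x, {x} ∈ meagreIdeal := fun x =>
    IsNowhereDense.isMeagre (by simp [IsNowhereDense])
  have hMu : Set.univ ∉ meagreIdeal := not_isMeagre_of_isOpen isOpen_univ Set.univ_nonempty
  refine ⟨fun A hA => hS.isNullAdditive hA.le,
    aleph_one_lt_addChar hNa hNs hNu, aleph_one_lt_covChar hNa hNs hNu,
    aleph_one_lt_nonChar hNa hNs hNu, aleph_one_lt_cofChar hNa hNs hNu,
    aleph_one_lt_addChar hMa hMs hMu, aleph_one_lt_covChar hMa hMs hMu,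
    aleph_one_lt_nonChar hMa hMs hMu, aleph_one_lt_cofChar hMa hMs hMu,
    hb.aleph_one_lt_boundingNumber, hb.aleph_one_lt_dominatingNumber, ?_⟩
  have hc : ℵ₁ < #(Set.univ : Set ℝ) :=
    not_le.1 fun hc => hNu (mem_of_mk_le_aleph_one hNa hNs hc)
  rw [mk_univ, mk_real] at hc
  simpa using lift_lt.2 hc
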